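/- For a polynomial $P \in \mathbb{C}[t]$ put $P^{\dagger}(t) = P(-t)$ and let $\Delta P(t) = P(t+1)-P(t)$ be the forward difference operator. Put $\Delta^* P = -(\Delta P^{\dagger})^{\dagger}$, so that $\Delta^* P(t) = P(t) - P(t-1)$. For an integer $n \ge 0$ and polynomials $P, Q$ of degree at most $n$, the umbral polarity pairing of level $n$ is \[ \langle P, Q\rangle_n^{\Delta} = \sum_{p=0}^{n} (-1)^{n-p}\, \Delta^{p} P \cdot (\Delta^*)^{n-p} Q , \] which is a constant polynomial. For $-\infty \le a \le b \le +\infty$ let $V(a,b) = \{z \in \mathbb{C} : a \le \mathrm{Re}(z) \le b\}$, and for a polynomial $P$ let $V(P)$ be the smallest strip $V(a,b)$ containing all roots of $P$. \textbf{Theorem (Umbral Grace theorem).} Let $P$ and $Q$ be two polynomials in $\mathbb{C}[t]$ of degree exactly $n$ such that $\langle P, Q\rangle_n^{\Delta} = 0$. Then \[ V(P) \cap \left(V(Q) + \frac{n-1}{2}\right) \neq \emptyset . \] -/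

import Mathlib

open Polynomial

noncomputable section

namespace UmbralGrace

/-- The reflection `P ↦ P†`, where `P†(t) = P(-t)`. -/
def dagger : ℂ[X] →ₗ[ℂ] ℂ[X] where
  toFun P := P.comp (-X)
  map_add' P Q := by simp
  map_smul' c P := by simp

/-- The operator `d*`, where `d* P = -(d (P†))†`. -/
def starOp (d : ℂ[X] →ₗ[ℂ] ℂ[X]) : ℂ[X] →ₗ[ℂ] ℂ[X] :=
  -(dagger ∘ₗ d ∘ₗ dagger)

/-- The umbral polarity pairing of level `n` attached to the operator `d`:
`⟨A, B⟩ = ∑_{p=0}^n (-1)^(n-p) (d^p A) ((d*)^(n-p) B)`. -/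
def umbralPairing (d : ℂ[X] →ₗ[ℂ] ℂ[X]) (n : ℕ) (A B : ℂ[X]) : ℂ[X] :=
  ∑ p ∈ Finset.range (n + 1),
    (-1 : ℂ[X]) ^ (n - p) * ((d ^ p) A * ((starOp d) ^ (n - p)) B)

/-- The forward difference operator `Δ P(t) = P(t + 1) - P(t)`. -/
def forwardDiff : ℂ[X] →ₗ[ℂ] ℂ[X] where
  toFun P := P.comp (X + 1) - P
  map_add' P Q := by simp only [add_comp]; ring
  map_smul' c P := by simp [smul_sub]

/-- The operator `Δ*` is the backward difference operator. -/
theorem starOp_forwardDiff (P : ℂ[X]) : starOp forwardDiff P = P - P.comp (X - 1) := by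
  have h : (-1 + X : ℂ[X]) = X - 1 := by ring
  simp [starOp, forwardDiff, dagger, comp_assoc, h]

/-- The closed vertical strip `V(a, b) = {z | a ≤ Re z ≤ b}`, the bounds being allowed
to be infinite. -/
def strip (a b : EReal) : Set ℂ := {z | a ≤ (z.re : EReal) ∧ (z.re : EReal) ≤ b}

/-- The strips `V(a, b)`, `-∞ ≤ a ≤ b ≤ +∞`, that contain all roots of `P`. -/
def stripsContainingRoots (P : ℂ[X]) : Set (Set ℂ) :=
  {S | (∃ a b : EReal, a ≤ b ∧ S = strip a b) ∧ ∀ z : ℂ, P.IsRoot z → z ∈ S}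

/-- The smallest strip `V(P)` containing all roots of `P`, as the intersection of all of them. -/
def rootStrip (P : ℂ[X]) : Set ℂ := ⋂₀ stripsContainingRoots P

/-- For a nonconstant polynomial, `V(P)` really is the least strip containing the roots. -/
theorem isLeast_rootStrip (P : ℂ[X]) (hP : 0 < P.degree) :
    IsLeast (stripsContainingRoots P) (rootStrip P) := by
  have hP0 : P ≠ 0 := by rintro rfl; simp at hP
  obtain ⟨z₀, hz₀⟩ := Complex.exists_root hP
  have hmem : ∀ z, z ∈ P.roots.toFinset ↔ P.IsRoot z := by simp [hP0]
  have hne : P.roots.toFinset.Nonempty := ⟨z₀, (hmem z₀).2 hz₀⟩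
  obtain ⟨u, hu, hu'⟩ := Finset.exists_min_image P.roots.toFinset Complex.re hne
  obtain ⟨v, hv, hv'⟩ := Finset.exists_max_image P.roots.toFinset Complex.re hne
  have hS : strip u.re v.re ∈ stripsContainingRoots P := by
    refine ⟨⟨_, _, EReal.coe_le_coe_iff.2 (hu' v hv), rfl⟩, fun z hz => ⟨?_, ?_⟩⟩
    · exact EReal.coe_le_coe_iff.2 (hu' z ((hmem z).2 hz))
    · exact EReal.coe_le_coe_iff.2 (hv' z ((hmem z).2 hz))
  have heq : rootStrip P = strip u.re v.re := by
    apply Set.Subset.antisymm (Set.sInter_subset_of_mem hS)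
    rintro z ⟨hz1, hz2⟩ S ⟨⟨a, b, -, rfl⟩, hroots⟩
    exact ⟨(hroots u ((hmem u).1 hu)).1.trans hz1, hz2.trans (hroots v ((hmem v).1 hv)).2⟩
  exact ⟨heq ▸ hS, fun S h => Set.sInter_subset_of_mem h⟩

end UmbralGrace

end

namespace UmbralGrace

/-! The pairing has a polar-derivative recursion: deleting a factor `X - q` from `Q` on level `n +
1` amounts to replacing `P` by `umbralPolar n q P` on level `n` (`umbralPairing_X_sub_C_mul`).
Deleting all roots of `Q` leaves a nonzero multiple of one polynomial, so the pairing is nonzero as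
soon as no polar step produces zero.

This holds when the two strips are disjoint. If the roots of `P` satisfy `Re z ≤ b < Re q + n/2`,
those of `umbralPolar n q P` satisfy `Re z ≤ b - 1/2` (`umbralPolar_eval_ne_zero_of_re_le`). The
shift by `1/2` matches the drop of `(n - 1)/2` with the level, so the separation persists.
Reflection handles the other side. -/

/-- The operator `P ↦ (X - q - n) ΔP - (n + 1) P`, an umbral analogue of the polar derivative. -/
noncomputable def umbralPolar (n : ℕ) (q : ℂ) (P : ℂ[X]) : ℂ[X] :=
  (X - C q - (n : ℂ[X])) * forwardDiff P - ((n : ℂ[X]) + 1) * P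

theorem forwardDiff_apply (P : ℂ[X]) : forwardDiff P = P.comp (X + 1) - P := rfl

theorem eval_umbralPolar (n : ℕ) (q t : ℂ) (P : ℂ[X]) :
    (umbralPolar n q P).eval t = (t - q - n) * P.eval (t + 1) - (t - q + 1) * P.eval t := by
  simp only [umbralPolar, forwardDiff_apply, eval_sub, eval_mul, eval_X, eval_C, eval_natCast,
    eval_comp, eval_add, eval_one]
  ring

/-! ### Removing a root of `Q` from the pairing -/

theorem starOp_forwardDiff_X_sub_C_mul (q : ℂ) (g : ℂ[X]) :
    starOp forwardDiff ((X - C q) * g) =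
      (X - C q - 1) * starOp forwardDiff g + g := by
  simp only [starOp_forwardDiff, mul_comp, sub_comp, X_comp, C_comp]
  ring

theorem starOp_forwardDiff_pow_X_sub_C_mul (q : ℂ) (g : ℂ[X]) (k : ℕ) :
    (starOp forwardDiff ^ (k + 1)) ((X - C q) * g) =
      (X - C q - ((k : ℂ[X]) + 1)) * (starOp forwardDiff ^ (k + 1)) g
        + ((k : ℂ[X]) + 1) * (starOp forwardDiff ^ k) g := by
  induction k with
  | zero => simp [starOp_forwardDiff_X_sub_C_mul]
  | succ k ih =>
    rw [pow_succ', Module.End.mul_apply, ih, map_add]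
    have h1 : ∀ h : ℂ[X], starOp forwardDiff ((X - C q - ((k : ℂ[X]) + 1)) * h) =
        (X - C q - ((k : ℂ[X]) + 2)) * starOp forwardDiff h + h := by
      intro h
      have := starOp_forwardDiff_X_sub_C_mul (q + k + 1) h
      simp only [C_add, map_natCast, C_1] at this
      rw [show X - C q - ((k : ℂ[X]) + 1) = X - (C q + (k : ℂ[X]) + 1) by ring, this]
      ring
    have h2 : ∀ h : ℂ[X], starOp forwardDiff (((k : ℂ[X]) + 1) * h) =
        ((k : ℂ[X]) + 1) * starOp forwardDiff h := by
      intro h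
      simp only [starOp_forwardDiff, mul_comp, add_comp, natCast_comp, one_comp]
      ring
    rw [h1, h2, ← Module.End.mul_apply, ← pow_succ', ← Module.End.mul_apply, ← pow_succ']
    push_cast
    ring

theorem starOp_forwardDiff_pow_prod_eq_zero (s : Multiset ℂ) :
    (starOp forwardDiff ^ (s.card + 1)) (s.map fun q => X - C q).prod = 0 := by
  induction s using Multiset.induction_on with
  | empty => simp [starOp_forwardDiff]
  | cons q s ih =>
    rw [Multiset.map_cons, Multiset.prod_cons, Multiset.card_cons,
      starOp_forwardDiff_pow_X_sub_C_mul, ih, pow_succ', Module.End.mul_apply, ih]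
    simp

theorem forwardDiff_pow_umbralPolar (n : ℕ) (q : ℂ) (P : ℂ[X]) (p : ℕ) :
    (forwardDiff ^ p) (umbralPolar n q P) =
      (X - C q - (n : ℂ[X]) + (p : ℂ[X])) * (forwardDiff ^ (p + 1)) P
        - ((n : ℂ[X]) + 1 - (p : ℂ[X])) * (forwardDiff ^ p) P := by
  induction p with
  | zero => simp [umbralPolar]
  | succ p ih =>
    rw [pow_succ', Module.End.mul_apply, ih, pow_succ' _ (p + 1), Module.End.mul_apply,
      pow_succ' _ p, Module.End.mul_apply]
    generalize (forwardDiff ^ p) P = D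
    simp only [forwardDiff_apply, mul_comp, add_comp, sub_comp, X_comp, C_comp,
      natCast_comp, one_comp]
    push_cast
    ring

/-- The Leibniz rules for `Δ*` on the left and `Δ` on the right give the same terms `G p`; the
remaining terms `F p` differ only by a shift of the index. -/
theorem umbralPairing_X_sub_C_mul (n : ℕ) (q : ℂ) (P g : ℂ[X])
    (hg : (starOp forwardDiff ^ (n + 1)) g = 0) :
    umbralPairing forwardDiff (n + 1) P ((X - C q) * g) =
      umbralPairing forwardDiff n (umbralPolar n q P) g := by
  set F : ℕ → ℂ[X] := fun p => (-1) ^ (n + 1 - p) *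
    ((X - C q - ((n : ℂ[X]) + 1 - (p : ℂ[X]))) * ((forwardDiff ^ p) P *
      (starOp forwardDiff ^ (n + 1 - p)) g)) with hF
  set G : ℕ → ℂ[X] := fun p => (-1) ^ (n + 1 - p) *
    (((n : ℂ[X]) + 1 - (p : ℂ[X])) * ((forwardDiff ^ p) P *
      (starOp forwardDiff ^ (n - p)) g)) with hG
  have hL : umbralPairing forwardDiff (n + 1) P ((X - C q) * g) =
      ∑ p ∈ Finset.range (n + 1), (F p + G p) + F (n + 1) := by
    rw [umbralPairing, Finset.sum_range_succ]
    congr 1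
    · refine Finset.sum_congr rfl fun p hp => ?_
      have hp' : p ≤ n := Nat.lt_succ_iff.1 (Finset.mem_range.1 hp)
      obtain ⟨k, rfl⟩ := Nat.exists_eq_add_of_le hp'
      simp only [hF, hG, show p + k + 1 - p = k + 1 by omega, Nat.add_sub_cancel_left,
        starOp_forwardDiff_pow_X_sub_C_mul]
      push_cast
      ring
    · simp only [hF, Nat.sub_self, pow_zero, Module.End.one_apply]
      push_cast
      ring
  have hR : umbralPairing forwardDiff n (umbralPolar n q P) g =
      ∑ p ∈ Finset.range (n + 1), (F (p + 1) + G p) := by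
    rw [umbralPairing]
    refine Finset.sum_congr rfl fun p hp => ?_
    have hp' : p ≤ n := Nat.lt_succ_iff.1 (Finset.mem_range.1 hp)
    obtain ⟨k, rfl⟩ := Nat.exists_eq_add_of_le hp'
    simp only [hF, hG, show p + k + 1 - p = k + 1 by omega, Nat.add_sub_cancel_left,
      show p + k + 1 - (p + 1) = k by omega, forwardDiff_pow_umbralPolar]
    push_cast
    ring
  -- The one unmatched boundary term contains `(Δ*)^(n + 1) g`.
  have h0 : F 0 = 0 := by simp [hF, hg]
  rw [hL, hR, Finset.sum_add_distrib, Finset.sum_add_distrib, add_right_comm,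
    ← Finset.sum_range_succ, Finset.sum_range_succ', h0, add_zero]

theorem coeff_forwardDiff {n : ℕ} {P : ℂ[X]} (hP : P.natDegree ≤ n + 1) :
    (forwardDiff P).coeff n = ((n : ℂ) + 1) * P.coeff (n + 1) := by
  have h : P.comp (X + 1) = taylor 1 P := by simp [taylor_apply]
  have hd : (hasseDeriv n P).natDegree < 2 :=
    (natDegree_hasseDeriv_le P n).trans_lt (by omega)
  rw [forwardDiff_apply, coeff_sub, h, taylor_coeff, eval_eq_sum_range' hd]
  simp [Finset.sum_range_succ, hasseDeriv_coeff, add_comm 1 n]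

/-- In degree `n + 1` both terms contribute `(n + 1) * P.coeff (n + 1)`, and they cancel. -/
theorem natDegree_umbralPolar_le {n : ℕ} {P : ℂ[X]} (q : ℂ) (hP : P.natDegree ≤ n + 1) :
    (umbralPolar n q P).natDegree ≤ n := by
  rw [natDegree_le_iff_coeff_eq_zero]
  intro m hm
  obtain ⟨m, rfl⟩ := Nat.exists_eq_add_of_le' (Nat.one_le_of_lt hm)
  have h1 := coeff_forwardDiff (n := m) (P := P) (by omega)
  have h2 := coeff_forwardDiff (n := m + 1) (P := P) (by omega)
  rw [coeff_eq_zero_of_natDegree_lt (n := m + 1 + 1) (by omega), mul_zero] at h2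
  have h3 : umbralPolar n q P = X * forwardDiff P - C (q + n) * forwardDiff P
      - C ((n : ℂ) + 1) * P := by
    simp only [umbralPolar, C_add, map_natCast, C_1]
    ring
  rw [h3, coeff_sub, coeff_sub, coeff_X_mul, coeff_C_mul, coeff_C_mul, h1, h2]
  rcases eq_or_lt_of_le (Nat.lt_succ_iff.1 hm) with rfl | h
  · ring
  · rw [coeff_eq_zero_of_natDegree_lt (n := m + 1) (by omega)]
    ring

/-! ### Location of the roots of the polar derivative -/

/-- The real-part bound behind the addition formula of the hyperbolic cotangent. -/
theorem re_mul_add_one_div_add {w W : ℂ} {τ μ : ℝ} (hτ : 0 < τ) (hμ : 0 < μ)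
    (hw : τ ≤ w.re) (hW : τ / μ ≤ W.re) : τ / (μ + 1) ≤ ((w * W + 1) / (w + W)).re := by
  have hW0 : 0 < W.re := (div_pos hτ hμ).trans_le hW
  have hw0 : 0 < w.re := hτ.trans_le hw
  have hN : 0 < Complex.normSq (w + W) := by
    rw [Complex.normSq_pos]
    intro h
    have := congrArg Complex.re h
    simp only [Complex.add_re, Complex.zero_re] at this
    linarith
  have hN' := hN
  rw [Complex.normSq_apply] at hN'
  simp only [Complex.add_re, Complex.add_im] at hN'
  rw [Complex.div_re, ← add_div, div_le_div_iff₀ (by linarith) hN, Complex.normSq_apply]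
  simp only [Complex.add_re, Complex.add_im, Complex.mul_re, Complex.mul_im, Complex.one_re,
    Complex.one_im]
  rw [div_le_iff₀ hμ] at hW
  obtain ⟨a, b⟩ := w
  obtain ⟨c, d⟩ := W
  simp only at *
  have e : ((a * c - b * d + 1) * (a + c) + (a * d + b * c + 0) * (b + d)) =
      a * (c ^ 2 + d ^ 2) + c * (a ^ 2 + b ^ 2) + (a + c) := by ring
  rw [e]
  have h1 : τ * ((μ + 1) * (c ^ 2 + d ^ 2)) ≤ a * ((μ + 1) * (c ^ 2 + d ^ 2)) :=
    mul_le_mul_of_nonneg_right hw (by positivity)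
  have h2 : τ * ((μ + 1) * (a ^ 2 + b ^ 2)) ≤ c * μ * ((μ + 1) * (a ^ 2 + b ^ 2)) :=
    mul_le_mul_of_nonneg_right hW (by positivity)
  have h3 : τ * ((a + c) ^ 2 + (b + d) ^ 2) * μ ≤
      -- The difference of the two sides is `τ * |w - μ W|²`.
      τ * ((μ + 1) * (c ^ 2 + d ^ 2)) * μ + τ * ((μ + 1) * (a ^ 2 + b ^ 2)) := by
    nlinarith [mul_nonneg hτ.le (sq_nonneg (a - μ * c)), mul_nonneg hτ.le (sq_nonneg (b - μ * d))]
  have h4 : 0 ≤ (a + c) * (μ + 1) * μ := by positivity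
  refine le_of_mul_le_mul_right ?_ hμ
  nlinarith [mul_le_mul_of_nonneg_right h1 hμ.le]

/-- With `A = ∏ (u + 1)` and `B = ∏ u`, the Cayley transform `W = (A + B)/(A - B)` equals `2u + 1`
for a single factor, and adjoining `u` turns `W` into `(wW + 1)/(w + W)` with `w = 2u + 1`. -/
theorem exists_cayley_prod {τ : ℝ} (hτ : 0 < τ) (s : Multiset ℂ) (hs : s ≠ 0)
    (h : ∀ u ∈ s, τ ≤ 2 * u.re + 1) :
    ∃ W : ℂ, τ / s.card ≤ W.re ∧ (s.map (· + 1)).prod - s.prod ≠ 0 ∧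
      (s.map (· + 1)).prod + s.prod = W * ((s.map (· + 1)).prod - s.prod) := by
  induction s using Multiset.induction_on with
  | empty => exact absurd rfl hs
  | cons u s ih =>
    have hu := h u (Multiset.mem_cons_self u s)
    rcases eq_or_ne s 0 with rfl | hs0
    · refine ⟨2 * u + 1, by simpa using hu, by simp, ?_⟩
      simp
      ring
    · obtain ⟨W, h1, h2, h3⟩ := ih hs0 fun v hv => h v (Multiset.mem_cons_of_mem hv)
      have hcard : (0 : ℝ) < s.card := by exact_mod_cast Multiset.card_pos.2 hs0
      have hu' : τ ≤ (2 * u + 1 : ℂ).re := by simpa using hu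
      have hne : 2 * u + 1 + W ≠ 0 := by
        intro h0
        have h0' := congrArg Complex.re h0
        rw [Complex.add_re, Complex.zero_re] at h0'
        linarith [div_pos hτ hcard]
      simp only [Multiset.map_cons, Multiset.prod_cons, Multiset.card_cons, Nat.cast_add,
        Nat.cast_one]
      generalize (s.map (· + 1)).prod = A at *
      generalize s.prod = B at *
      have e : (u + 1) * A - u * B = (2 * u + 1 + W) * (A - B) / 2 := by
        linear_combination (1 / 2) * h3
      refine ⟨_, re_mul_add_one_div_add hτ hcard hu' h1, ?_, ?_⟩
      · rw [e]
        exact div_ne_zero (mul_ne_zero hne h2) two_ne_zero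
      · rw [e]
        rw [← mul_div_assoc, ← mul_assoc, div_mul_cancel₀ _ hne]
        linear_combination (2 * u + 1) / 2 * h3

theorem umbralPolar_eval_ne_zero_of_re_le {n : ℕ} {P : ℂ[X]} {q t : ℂ} {b : ℝ} (hP0 : P ≠ 0)
    (hP : P.natDegree ≤ n + 1) (hroots : ∀ z, P.IsRoot z → z.re ≤ b) (hb : b < q.re + n / 2)
    (ht : b - 1 / 2 < t.re) : (umbralPolar n q P).eval t ≠ 0 := by
  have hev : ∀ x, P.eval x = P.leadingCoeff * (P.roots.map fun z => x - z).prod := by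
    intro x
    conv_lhs => rw [← C_leadingCoeff_mul_prod_multiset_X_sub_C
      (splits_iff_card_roots.1 (IsAlgClosed.splits P))]
    simp [eval_multiset_prod]
  have hlc : P.leadingCoeff ≠ 0 := leadingCoeff_ne_zero.2 hP0
  rw [eval_umbralPolar, hev, hev]
  set s : Multiset ℂ := P.roots.map fun z => t - z with hsdef
  have hA : (P.roots.map fun z => t + 1 - z) = s.map (· + 1) := by
    rw [hsdef, Multiset.map_map]
    refine Multiset.map_congr rfl fun z _ => ?_
    simp only [Function.comp]
    ring
  rw [hA]
  intro h0
  have h1 : (t - q - n) * (s.map (· + 1)).prod - (t - q + 1) * s.prod = 0 :=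
    mul_left_cancel₀ hlc (by linear_combination h0)
  rcases eq_or_ne s 0 with hs | hs
  · rw [hs] at h1
    simp only [Multiset.map_zero, Multiset.prod_zero, mul_one] at h1
    have h2 : ((n + 1 : ℕ) : ℂ) = 0 := by
      push_cast
      linear_combination -h1
    exact Nat.succ_ne_zero n (by exact_mod_cast h2)
  · have hτ : 0 < 2 * (t.re - b) + 1 := by linarith
    obtain ⟨W, hW, hne, hAB⟩ := exists_cayley_prod hτ s hs (by
      intro u hu
      obtain ⟨z, hz, rfl⟩ := Multiset.mem_map.1 hu
      have := hroots z (isRoot_of_mem_roots hz)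
      rw [Complex.sub_re]
      linarith)
    have hcard0 : (0 : ℝ) < s.card := by exact_mod_cast Multiset.card_pos.2 hs
    have hcard : (s.card : ℝ) ≤ n + 1 := by
      have : s.card ≤ n + 1 := by
        rw [hsdef, Multiset.card_map]
        exact (card_roots' P).trans hP
      exact_mod_cast this
    have hWt : (2 * (t.re - b) + 1) / (n + 1) ≤ W.re :=
      (div_le_div_of_nonneg_left hτ.le hcard0 hcard).trans hW
    rw [div_le_iff₀ (by positivity)] at hWt
    -- Vanishing at `t` says `(n + 1) W = 2(t - q) + 1 - n`; with the lower bound on `Re W` this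
    -- forces `Re q + n/2 ≤ b`.
    have h2 : 2 * (t - q - n) = (n + 1) * (W - 1) := by
      refine mul_right_cancel₀ hne ?_
      linear_combination 2 * h1 + ((n : ℂ) + 1) * hAB
    have h3 := congrArg Complex.re h2
    simp at h3
    nlinarith

/-- This symmetry exchanges the left and right half-plane statements. -/
theorem umbralPolar_comp_neg_X (n : ℕ) (q t : ℂ) (P : ℂ[X]) :
    (umbralPolar n (-q - n) (P.comp (-X))).eval (-t - 1) = (umbralPolar n q P).eval t := by
  simp only [eval_umbralPolar, eval_comp, eval_neg, eval_X]
  ring_nf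

theorem umbralPolar_eval_ne_zero_of_le_re {n : ℕ} {P : ℂ[X]} {q t : ℂ} {a : ℝ} (hP0 : P ≠ 0)
    (hP : P.natDegree ≤ n + 1) (hroots : ∀ z, P.IsRoot z → a ≤ z.re) (ha : q.re + n / 2 < a)
    (ht : t.re < a - 1 / 2) : (umbralPolar n q P).eval t ≠ 0 := by
  rw [← umbralPolar_comp_neg_X]
  refine umbralPolar_eval_ne_zero_of_re_le (b := -a) ?_ ?_ ?_ ?_ ?_
  · rwa [Ne, comp_neg_X_eq_zero_iff]
  · simpa [natDegree_comp] using hP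
  · intro z hz
    have := hroots (-z) (by simpa [IsRoot, eval_comp] using hz)
    rw [Complex.neg_re] at this
    linarith
  · simp
    linarith
  · simp
    linarith

/-! ### Nonvanishing of the pairing for separated strips -/

/-- `S n` is the invariant kept on level `n`, and `T` is the region of the roots removed. On level
`0` the pairing with `1` is `P` itself. -/
theorem umbralPairing_prod_ne_zero {T : Set ℂ} {S : ℕ → ℂ[X] → Prop}
    (hS : ∀ n P, S n P → P ≠ 0)
    (hstep : ∀ n P, S (n + 1) P → ∀ q ∈ T, S n (umbralPolar n q P)) (s : Multiset ℂ)
    (hs : ∀ q ∈ s, q ∈ T) (P : ℂ[X]) (hP : S s.card P) :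
    umbralPairing forwardDiff s.card P (s.map fun q => X - C q).prod ≠ 0 := by
  induction s using Multiset.induction_on generalizing P with
  | empty => simpa [umbralPairing] using hS _ _ hP
  | cons q s ih =>
    rw [Multiset.card_cons] at hP
    rw [Multiset.map_cons, Multiset.prod_cons, Multiset.card_cons,
      umbralPairing_X_sub_C_mul _ _ _ _ (starOp_forwardDiff_pow_prod_eq_zero s)]
    exact ih (fun v hv => hs v (Multiset.mem_cons_of_mem hv)) _
      (hstep _ _ hP q (hs q (Multiset.mem_cons_self q s)))

theorem umbralPairing_C_mul (n : ℕ) (c : ℂ) (P Q : ℂ[X]) :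
    umbralPairing forwardDiff n P (C c * Q) = C c * umbralPairing forwardDiff n P Q := by
  simp only [umbralPairing, Finset.mul_sum, ← smul_eq_C_mul, map_smul, mul_smul_comm]

theorem umbralPairing_ne_zero {T : Set ℂ} {S : ℕ → ℂ[X] → Prop}
    (hS : ∀ n P, S n P → P ≠ 0)
    (hstep : ∀ n P, S (n + 1) P → ∀ q ∈ T, S n (umbralPolar n q P)) {P Q : ℂ[X]} (hQ0 : Q ≠ 0)
    (hQ : ∀ q, Q.IsRoot q → q ∈ T) (hP : S Q.natDegree P) :
    umbralPairing forwardDiff Q.natDegree P Q ≠ 0 := by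
  have hcard := splits_iff_card_roots.1 (IsAlgClosed.splits Q)
  have h := umbralPairing_prod_ne_zero hS hstep Q.roots
    (fun q hq => hQ q (isRoot_of_mem_roots hq)) P (by rwa [hcard])
  rw [hcard] at h
  have h2 := umbralPairing_C_mul Q.natDegree Q.leadingCoeff P (Q.roots.map fun q => X - C q).prod
  rw [C_leadingCoeff_mul_prod_multiset_X_sub_C hcard] at h2
  rw [h2]
  exact mul_ne_zero (C_ne_zero.2 (leadingCoeff_ne_zero.2 hQ0)) h

theorem umbralPairing_ne_zero_of_re_lt {n : ℕ} {P Q : ℂ[X]} {b c : ℝ} (hP : P.degree = n)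
    (hQ : Q.degree = n) (hPb : ∀ z, P.IsRoot z → z.re ≤ b) (hQc : ∀ z, Q.IsRoot z → c ≤ z.re)
    (hbc : b < c + ((n : ℝ) - 1) / 2) : umbralPairing forwardDiff n P Q ≠ 0 := by
  have hP0 : P ≠ 0 := by rintro rfl; simp at hP
  have hQ0 : Q ≠ 0 := by rintro rfl; simp at hQ
  have hn := natDegree_eq_of_degree_eq_some hQ
  rw [← hn]
  -- The degree is only bounded by the level, since a polar step may lower it by more than one.
  refine umbralPairing_ne_zero (T := {q | c ≤ q.re})
    (S := fun m R => R ≠ 0 ∧ R.natDegree ≤ m ∧ ∃ b : ℝ, (∀ z, R.IsRoot z → z.re ≤ b) ∧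
      b < c + ((m : ℝ) - 1) / 2) (fun _ _ h => h.1) ?_ hQ0 hQc
    ⟨hP0, ?_, b, hPb, by rwa [hn]⟩
  · rintro m R ⟨hR0, hR, b, hb, hbc⟩ q hq
    have hq' : c ≤ q.re := hq
    push_cast at hbc
    have key : ∀ t : ℂ, b - 1 / 2 < t.re → (umbralPolar m q R).eval t ≠ 0 := fun t ht =>
      umbralPolar_eval_ne_zero_of_re_le hR0 hR hb (by linarith) ht
    refine ⟨?_, natDegree_umbralPolar_le q hR, b - 1 / 2,
      fun z hz => not_lt.1 fun h => key z h hz, by linarith⟩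
    intro h
    -- Any point right of `b - 1/2` shows that the new polynomial is nonzero.
    exact key (b : ℂ) (by simp) (by rw [h, eval_zero])
  · rw [hn, natDegree_eq_of_degree_eq_some hP]

theorem umbralPairing_ne_zero_of_lt_re {n : ℕ} {P Q : ℂ[X]} {a d : ℝ} (hP : P.degree = n)
    (hQ : Q.degree = n) (hPa : ∀ z, P.IsRoot z → a ≤ z.re) (hQd : ∀ z, Q.IsRoot z → z.re ≤ d)
    (hda : d + ((n : ℝ) - 1) / 2 < a) : umbralPairing forwardDiff n P Q ≠ 0 := by
  have hP0 : P ≠ 0 := by rintro rfl; simp at hP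
  have hQ0 : Q ≠ 0 := by rintro rfl; simp at hQ
  have hn := natDegree_eq_of_degree_eq_some hQ
  rw [← hn]
  refine umbralPairing_ne_zero (T := {q | q.re ≤ d})
    (S := fun m R => R ≠ 0 ∧ R.natDegree ≤ m ∧ ∃ a : ℝ, (∀ z, R.IsRoot z → a ≤ z.re) ∧
      d + ((m : ℝ) - 1) / 2 < a) (fun _ _ h => h.1) ?_ hQ0 hQd
    ⟨hP0, ?_, a, hPa, by rwa [hn]⟩
  · rintro m R ⟨hR0, hR, a, ha, hda⟩ q hq
    have hq' : q.re ≤ d := hq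
    push_cast at hda
    have key : ∀ t : ℂ, t.re < a - 1 / 2 → (umbralPolar m q R).eval t ≠ 0 := fun t ht =>
      umbralPolar_eval_ne_zero_of_le_re hR0 hR ha (by linarith) ht
    refine ⟨?_, natDegree_umbralPolar_le q hR, a - 1 / 2,
      fun z hz => not_lt.1 fun h => key z h hz, by linarith⟩
    intro h
    exact key ((a - 1 : ℝ) : ℂ) (by rw [Complex.ofReal_re]; linarith) (by rw [h, eval_zero])
  · rw [hn, natDegree_eq_of_degree_eq_some hP]

/-! ### From extreme roots to intersecting strips -/

theorem mem_rootStrip {P : ℂ[X]} {u v z : ℂ} (hu : P.IsRoot u) (hv : P.IsRoot v)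
    (huz : u.re ≤ z.re) (hzv : z.re ≤ v.re) : z ∈ rootStrip P := by
  rintro S ⟨⟨a, b, -, rfl⟩, hroots⟩
  exact ⟨(hroots u hu).1.trans (EReal.coe_le_coe_iff.2 huz),
    (EReal.coe_le_coe_iff.2 hzv).trans (hroots v hv).2⟩

theorem exists_extreme_roots {P : ℂ[X]} (hP : 0 < P.degree) :
    ∃ u v : ℂ, P.IsRoot u ∧ P.IsRoot v ∧ ∀ z, P.IsRoot z → u.re ≤ z.re ∧ z.re ≤ v.re := by
  have hP0 : P ≠ 0 := by rintro rfl; simp at hP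
  obtain ⟨z₀, hz₀⟩ := Complex.exists_root hP
  have hmem : ∀ z, z ∈ P.roots.toFinset ↔ P.IsRoot z := by simp [hP0]
  have hne : P.roots.toFinset.Nonempty := ⟨z₀, (hmem z₀).2 hz₀⟩
  obtain ⟨u, hu, hu'⟩ := Finset.exists_min_image P.roots.toFinset Complex.re hne
  obtain ⟨v, hv, hv'⟩ := Finset.exists_max_image P.roots.toFinset Complex.re hne
  exact ⟨u, v, (hmem u).1 hu, (hmem v).1 hv,
    fun z hz => ⟨hu' z ((hmem z).2 hz), hv' z ((hmem z).2 hz)⟩⟩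

end UmbralGrace

theorem mainTheorem1 (n : ℕ) (P Q : ℂ[X]) (hP : P.degree = n) (hQ : Q.degree = n)
    (hPQ : UmbralGrace.umbralPairing UmbralGrace.forwardDiff n P Q = 0) :
    (UmbralGrace.rootStrip P ∩
      (fun z : ℂ => z + ((n : ℂ) - 1) / 2) '' UmbralGrace.rootStrip Q).Nonempty := by
  rcases Nat.eq_zero_or_pos n with rfl | hn
  -- For constants the pairing is the product `P * Q`, which is nonzero.
  · have hP0 : P ≠ 0 := by rintro rfl; simp at hP
    have hQ0 : Q ≠ 0 := by rintro rfl; simp at hQ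
    simp [UmbralGrace.umbralPairing, hP0, hQ0] at hPQ
  obtain ⟨u, v, hu, hv, huv⟩ := UmbralGrace.exists_extreme_roots (P := P)
    (by rw [hP]; exact_mod_cast hn)
  obtain ⟨u', v', hu', hv', huv'⟩ := UmbralGrace.exists_extreme_roots (P := Q)
    (by rw [hQ]; exact_mod_cast hn)
  have h1 : u'.re + ((n : ℝ) - 1) / 2 ≤ v.re := not_lt.1 fun h =>
    UmbralGrace.umbralPairing_ne_zero_of_re_lt hP hQ (fun z hz => (huv z hz).2)
      (fun z hz => (huv' z hz).1) h hPQ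
  have h2 : u.re ≤ v'.re + ((n : ℝ) - 1) / 2 := not_lt.1 fun h =>
    UmbralGrace.umbralPairing_ne_zero_of_lt_re hP hQ (fun z hz => (huv z hz).1)
      (fun z hz => (huv' z hz).2) h hPQ
  have h3 := (huv u hu).2
  have h4 := (huv' u' hu').2
  -- Two real intervals, neither wholly to one side of the other, share the larger of their left
  -- endpoints.
  set x : ℝ := max u.re (u'.re + ((n : ℝ) - 1) / 2) with hx
  have hx1 : u.re ≤ x := le_max_left _ _
  have hx2 : u'.re + ((n : ℝ) - 1) / 2 ≤ x := le_max_right _ _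
  have hx3 : x ≤ v.re := max_le h3 h1
  have hx4 : x ≤ v'.re + ((n : ℝ) - 1) / 2 := max_le h2 (by linarith)
  refine ⟨(x : ℂ), UmbralGrace.mem_rootStrip hu hv (by simpa using hx1) (by simpa using hx3),
    ((x - ((n : ℝ) - 1) / 2 : ℝ) : ℂ), UmbralGrace.mem_rootStrip hu' hv' ?_ ?_, ?_⟩
  · rw [Complex.ofReal_re]
    linarith
  · rw [Complex.ofReal_re]
    linarith
  · push_cast
    ring
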